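/- Let $n\ge 0$ be an integer, let $\|\cdot\|$ be the Euclidean norm on $\mathbb R^n$ and let $\gamma_n$ be the standard Gaussian probability measure on $\mathbb R^n$ (the product of $n$ copies of the measure with density $\frac{1}{\sqrt{2\pi}}e^{-x^2/2}$ on $\mathbb R$). (1) Every Lipschitz function $\varphi:\mathbb R^n\to\mathbb R$ is differentiable $\gamma_n$-almost everywhere, both integrals below are finite, and $$\frac12\iint (\varphi(x)-\varphi(y))^2\,d\gamma_n(x)\,d\gamma_n(y)\;\le\;\int\|\nabla\varphi\|^2\,d\gamma_n .$$ (2) For functions $f,g$ on $\mathbb R^n$ write $(f\,\square\, g)(x)=\inf\{f(x-y)+g(y):\ y\in\mathbb R^n\}$. For a Borel probability measure $\mu$ on $\mathbb R^n$ and a nonnegative measurable function $w:\mathbb R^n\to[0,\infty)$, say that $(\mu,w)$ satisfies property $(\tau)$ if for every bounded measurable function $\varphi:\mathbb R^n\to\mathbb R$ $$\Bigl(\int e^{\varphi\square w}\,d\mu\Bigr)\Bigl(\int e^{-\varphi}\,d\mu\Bigr)\le 1 .$$ If $(\mu,w)$ satisfies $(\tau)$ for some nonnegative convex function $w:\mathbb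 R^n\to[0,\infty)$ with $w(x)\ge\frac14\|x\|^2$ for all $x$ in a neighbourhood of $0$, then for every Lipschitz function $\varphi:\mathbb R^n\to\mathbb R$ that is differentiable $\mu$-almost everywhere (by Rademacher's theorem this is automatic when $\mu$ is absolutely continuous with respect to Lebesgue measure), both integrals below are finite and $$\frac12\iint (\varphi(x)-\varphi(y))^2\,d\mu(x)\,d\mu(y)\;\le\;\int\|\nabla\varphi\|^2\,d\mu .$$ -/

import Mathlib

open MeasureTheory ProbabilityTheory Filter Topology
open scoped NNReal ENNReal Gradient

/-- The inf-convolution `x ↦ inf { f (x - y) + g y ; y ∈ ℝⁿ }`. (The infimum is a genuine one as soon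
as `f` and `g` are bounded below.) -/
noncomputable def infConv {n : ℕ} (f g : EuclideanSpace ℝ (Fin n) → ℝ) :
    EuclideanSpace ℝ (Fin n) → ℝ :=
  fun x => ⨅ y : EuclideanSpace ℝ (Fin n), (f (x - y) + g y)

/-- Property (τ) for a couple `(μ, w)`, where `w` is a nonnegative measurable function: for every
bounded measurable `φ`, `(∫ exp (φ □ w) dμ) (∫ exp (-φ) dμ) ≤ 1`. -/
def PropertyTau {n : ℕ} (μ : Measure (EuclideanSpace ℝ (Fin n)))
    (w : EuclideanSpace ℝ (Fin n) → ℝ) : Prop :=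
  ∀ φ : EuclideanSpace ℝ (Fin n) → ℝ, Measurable φ → (∃ C : ℝ, ∀ x, |φ x| ≤ C) →
    (∫⁻ x, ENNReal.ofReal (Real.exp (infConv φ w x)) ∂μ) *
      (∫⁻ x, ENNReal.ofReal (Real.exp (-φ x)) ∂μ) ≤ 1

/-- The inequality `½ ∫∫ (φ x - φ y)² dμ(x) dμ(y) ≤ ∫ ‖∇φ‖² dμ`, together with the finiteness of
both integrals. -/
def PoincareIneq {n : ℕ} (μ : Measure (EuclideanSpace ℝ (Fin n)))
    (φ : EuclideanSpace ℝ (Fin n) → ℝ) : Prop :=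
  Integrable (fun z : EuclideanSpace ℝ (Fin n) × EuclideanSpace ℝ (Fin n) =>
      (φ z.1 - φ z.2) ^ 2) (μ.prod μ) ∧
    Integrable (fun x => ‖∇ φ x‖ ^ 2) μ ∧
    (1 / 2 : ℝ) * ∫ z : EuclideanSpace ℝ (Fin n) × EuclideanSpace ℝ (Fin n),
        (φ z.1 - φ z.2) ^ 2 ∂(μ.prod μ) ≤ ∫ x, ‖∇ φ x‖ ^ 2 ∂μ

/-!
Both parts reduce, by `poincareIneq_of_lintegral_le`, to a bound between `ℝ≥0∞`-valued integrals.

**Property (τ).** Apply (τ) to `t ψ`, with `ψ` a truncation of `φ` and `t` small. Near the origin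
`w` dominates `‖·‖² / 4`, whose infimal convolution with a linear function of slope `t ‖∇φ x‖` costs
`t² ‖∇φ x‖²`; hence `(t ψ) □ w ≥ t ψ - t² F_t` with `limsup F_t ≤ ‖∇φ‖²`. Substituting in (τ) and
using `exp (-s) ≥ 1 - s` gives, with `Δ (x, y) = ψ x - ψ y`,
`∬ exp (t Δ) ≤ 1 + t² ∬ exp (t Δ) F_t (x)`.
Symmetrizing in `(x, y)` turns the left side into `∬ cosh (t Δ) ≥ 1 + (t² / 2) ∬ Δ²`, and `t → 0`
gives the claim for `ψ` (`PropertyTau.half_integral_sq_le`,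
`PropertyTau.half_integral_sq_le_integral_gradient`). Fatou's lemma removes the truncation.
The local bound on `w` controls `w` far from the origin only if `w 0 = 0`. This is not assumed; it
follows from (τ), tested on truncations of a linear function below `w` up to a constant
(`PropertyTau.apply_zero`).

**Gaussian measure.** In dimension one, Cauchy-Schwarz gives
`(f x - f y)² ≤ (x - y) ∫_y^x f'²` for `y ≤ x`; integrating in `(x, y)` and exchanging the
integrals, the weight of `f'(s)²` is `∬_{y < s ≤ x} (x - y)`, which is exactly the Gaussian density
at `s` (`lintegral_crossingKernel`). The inequality is then tensorized: for commuting
measure-preserving involutions the energies `∫ (g - g ∘ S)²` are subadditive under composition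
(`MeasureTheory.MeasurePreserving.lintegral_sq_sub_comp_comp_le`), and exchanging two independent
copies of a random vector is the composition of the exchanges of the single coordinates
(`lintegral_sq_sub_pi_le`). Rademacher's theorem identifies the sum of the squared partial
derivatives with `‖∇φ‖²` almost everywhere.
-/

/-! ### Gradients of Lipschitz functions and the Poincaré inequality -/

theorem LipschitzWith.norm_gradient_le {F : Type*} [NormedAddCommGroup F] [InnerProductSpace ℝ F]
    [CompleteSpace F] {φ : F → ℝ} {K : ℝ≥0} (hφ : LipschitzWith K φ) (x : F) : ‖∇ φ x‖ ≤ K := by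
  rw [gradient, LinearIsometryEquiv.norm_map]
  exact norm_fderiv_le_of_lipschitz ℝ hφ

theorem measurable_gradient {F : Type*} [NormedAddCommGroup F] [InnerProductSpace ℝ F]
    [CompleteSpace F] [MeasurableSpace F] [BorelSpace F] (φ : F → ℝ) : Measurable (∇ φ) :=
  (InnerProductSpace.toDual ℝ F).symm.continuous.measurable.comp (measurable_fderiv ℝ φ)

theorem LipschitzWith.integrable_norm_gradient_sq {n : ℕ}
    {μ : Measure (EuclideanSpace ℝ (Fin n))} [IsFiniteMeasure μ]
    {φ : EuclideanSpace ℝ (Fin n) → ℝ} {K : ℝ≥0} (hφ : LipschitzWith K φ) :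
    Integrable (fun x => ‖∇ φ x‖ ^ 2) μ := by
  refine Integrable.of_bound ((measurable_gradient φ).norm.pow_const 2).aestronglyMeasurable
    ((K : ℝ) ^ 2) (Eventually.of_forall fun x => ?_)
  rw [Real.norm_of_nonneg (by positivity)]
  exact pow_le_pow_left₀ (norm_nonneg _) (hφ.norm_gradient_le x) 2

/-- For a Lipschitz function the gradient term is always integrable, so a bound on the lower
integral of `(φ x - φ y)²` yields both the finiteness and the inequality in `PoincareIneq`. -/
theorem poincareIneq_of_lintegral_le {n : ℕ} {μ : Measure (EuclideanSpace ℝ (Fin n))}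
    [IsProbabilityMeasure μ] {φ : EuclideanSpace ℝ (Fin n) → ℝ} {K : ℝ≥0}
    (hφ : LipschitzWith K φ)
    (h : ∫⁻ z, ENNReal.ofReal ((φ z.1 - φ z.2) ^ 2) ∂(μ.prod μ) ≤
      ENNReal.ofReal (2 * ∫ x, ‖∇ φ x‖ ^ 2 ∂μ)) :
    PoincareIneq μ φ := by
  have hφc := hφ.continuous
  have hm : AEStronglyMeasurable
      (fun z : EuclideanSpace ℝ (Fin n) × EuclideanSpace ℝ (Fin n) => (φ z.1 - φ z.2) ^ 2)
      (μ.prod μ) := by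
    fun_prop
  have hnn : 0 ≤ ∫ x, ‖∇ φ x‖ ^ 2 ∂μ := integral_nonneg fun x => by positivity
  refine ⟨⟨hm, ?_⟩, hφ.integrable_norm_gradient_sq, ?_⟩
  · rw [hasFiniteIntegral_iff_ofReal (Eventually.of_forall fun z => by positivity)]
    exact h.trans_lt ENNReal.ofReal_lt_top
  · rw [integral_eq_lintegral_of_nonneg_ae (Eventually.of_forall fun z => by positivity) hm]
    have := ENNReal.toReal_mono ENNReal.ofReal_ne_top h
    rw [ENNReal.toReal_ofReal (by positivity)] at this
    linarith

/-! ### Infimal convolution with a convex function -/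

section InfConv

variable {n : ℕ} {φ ψ w : EuclideanSpace ℝ (Fin n) → ℝ}

theorem bddBelow_range_infConv {C : ℝ} (hψ : ∀ x, C ≤ ψ x) (hw : ∀ x, 0 ≤ w x)
    (x : EuclideanSpace ℝ (Fin n)) : BddBelow (Set.range fun y => ψ (x - y) + w y) :=
  ⟨C, by rintro _ ⟨y, rfl⟩; exact le_add_of_le_of_nonneg (hψ _) (hw y)⟩

theorem lipschitzWith_infConv {K : ℝ≥0} (hψ : LipschitzWith K ψ) {C : ℝ} (hC : ∀ x, C ≤ ψ x)
    (hw : ∀ x, 0 ≤ w x) : LipschitzWith K (infConv ψ w) := by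
  refine LipschitzWith.of_le_add_mul K fun x y => ?_
  rw [← sub_le_iff_le_add]
  refine le_ciInf fun z => ?_
  have h1 := ciInf_le (bddBelow_range_infConv hC hw x) z
  have h2 := hψ.le_add_mul (x - z) (y - z)
  rw [dist_sub_right] at h2
  change infConv ψ w x ≤ _ at h1
  linarith

/-- A convex function vanishing at the origin grows at least linearly outside a ball on whose
boundary it is bounded below. -/
theorem ConvexOn.mul_norm_le_of_sq_le {r : ℝ} (hconv : ConvexOn ℝ Set.univ w) (hw0 : w 0 = 0)
    (hr : 0 < r) (h : ∀ y, ‖y‖ ≤ r → (1 / 4 : ℝ) * ‖y‖ ^ 2 ≤ w y)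
    {y : EuclideanSpace ℝ (Fin n)} (hy : r ≤ ‖y‖) : r / 4 * ‖y‖ ≤ w y := by
  have hy0 : 0 < ‖y‖ := hr.trans_le hy
  have hs : r / ‖y‖ ≤ 1 := (div_le_one hy0).2 hy
  have h1 := hconv.2 (Set.mem_univ y) (Set.mem_univ 0)
    (show 0 ≤ r / ‖y‖ by positivity) (show 0 ≤ 1 - r / ‖y‖ by linarith) (by ring)
  have hn : ‖(r / ‖y‖) • y‖ = r := by
    rw [norm_smul, Real.norm_of_nonneg (by positivity)]; field_simp
  have h2 := h ((r / ‖y‖) • y) hn.le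
  rw [hn] at h2
  simp only [smul_zero, add_zero, hw0, smul_eq_mul, mul_zero] at h1
  have h3 : 1 / 4 * r ^ 2 ≤ r * w y / ‖y‖ := by
    rw [← div_mul_eq_mul_div]; exact h2.trans h1
  rw [le_div_iff₀ hy0] at h3
  refine le_of_mul_le_mul_left ?_ hr
  linarith

/-- If `ψ` has slope at most `L` around `x` up to distance `r`, then the infimal convolution of
`t ψ` with `w` loses at most `t² L²` at `x`. Points at distance more than `r` do not matter: there
the linear growth of `w`, of slope `r / 4`, exceeds the variation of `t ψ`, of slope `t K`. -/
theorem le_infConv_of_local {r t L : ℝ} {K : ℝ≥0} (hconv : ConvexOn ℝ Set.univ w)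
    (hw0 : w 0 = 0) (hr : 0 < r) (h : ∀ y, ‖y‖ ≤ r → (1 / 4 : ℝ) * ‖y‖ ^ 2 ≤ w y)
    (hψ : LipschitzWith K ψ) (ht : 0 ≤ t) (htK : t * K ≤ r / 4)
    {x : EuclideanSpace ℝ (Fin n)} (hL : ∀ y, ‖y‖ ≤ r → |ψ (x - y) - ψ x| ≤ L * ‖y‖) :
    t * ψ x - t ^ 2 * L ^ 2 ≤ infConv (fun z => t * ψ z) w x := by
  refine le_ciInf fun y => ?_
  rcases le_total ‖y‖ r with hy | hy
  · have h1 := (abs_le.1 (hL y hy)).1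
    have h2 := h y hy
    -- `-t L ‖y‖ + ‖y‖² / 4 ≥ -t² L²`, by completing the square
    nlinarith [sq_nonneg (t * L - ‖y‖ / 2), mul_le_mul_of_nonneg_left h1 ht]
  · have h1 := hψ.le_add_mul x (x - y)
    have h2 := hconv.mul_norm_le_of_sq_le hw0 hr h hy
    rw [dist_eq_norm, sub_sub_cancel] at h1
    nlinarith [mul_le_mul_of_nonneg_left h1 ht, mul_le_mul_of_nonneg_right htK (norm_nonneg y),
      mul_nonneg (sq_nonneg t) (sq_nonneg L)]

end InfConv

/-! ### Consequences of property (τ) -/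

/-- Here `a` and `s` stand for the values at `x` and `y` of a linear function and `v` for `w y`:
where `|a| ≤ N`, the infimal convolution of the truncated linear function with `w` gains the
constant `c`. -/
theorem clamp_add_le {N c a s v : ℝ} (hc : 0 < c) (hN : 0 ≤ N) (ha : -N ≤ a) (ha' : a ≤ N)
    (h1 : s + c ≤ v) (h2 : 0 ≤ v) :
    max (-(N + c)) (min (N + c) a) + c ≤ max (-(N + c)) (min (N + c) (a - s)) + v := by
  rw [min_eq_right (by linarith), max_eq_right (by linarith)]
  rcases le_total (N + c) (a - s) with h | h
  · rw [min_eq_left h, max_eq_right (by linarith)]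
    linarith
  · rw [min_eq_right h]
    linarith [le_max_right (-(N + c)) (a - s)]

theorem clamp_le {N c a s v : ℝ} (hc : 0 < c) (h1 : s + c ≤ v) (h2 : 0 ≤ v) :
    max (-(N + c)) (min (N + c) a) ≤ max (-(N + c)) (min (N + c) (a - s)) + v := by
  refine max_le (by linarith [le_max_left (-(N + c)) (min (N + c) (a - s))]) ?_
  rcases le_total (N + c) (a - s) with h | h
  · rw [min_eq_left h]
    linarith [le_max_right (-(N + c)) (N + c), min_le_left (N + c) a]
  · rw [min_eq_right h]
    linarith [le_max_right (-(N + c)) (a - s), min_le_right (N + c) a]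

section PropertyTau

variable {n : ℕ} {μ : Measure (EuclideanSpace ℝ (Fin n))} [IsProbabilityMeasure μ]
  {φ ψ w : EuclideanSpace ℝ (Fin n) → ℝ}

/-- Property (τ) written as a double integral, for a bounded minorant `u` of `ψ □ w`. -/
theorem PropertyTau.integral_exp_sub_le_one (hτ : PropertyTau μ w) {C : ℝ} (hψ : Measurable ψ)
    (hC : ∀ x, |ψ x| ≤ C) {u : EuclideanSpace ℝ (Fin n) → ℝ} (hu : Measurable u) {D : ℝ}
    (hD : ∀ x, |u x| ≤ D) (huψ : ∀ x, u x ≤ infConv ψ w x) :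
    ∫ z, Real.exp (u z.1 - ψ z.2) ∂(μ.prod μ) ≤ 1 := by
  have h1 := hτ ψ hψ ⟨C, hC⟩
  have h2 : (∫⁻ x, ENNReal.ofReal (Real.exp (u x)) ∂μ) *
      (∫⁻ x, ENNReal.ofReal (Real.exp (-ψ x)) ∂μ) ≤ 1 :=
    le_trans (by gcongr with x; exact huψ x) h1
  have hi1 : Integrable (fun x => Real.exp (u x)) μ :=
    Integrable.of_bound (by fun_prop) (Real.exp D) (Eventually.of_forall fun x => by
      rw [Real.norm_of_nonneg (Real.exp_pos _).le]
      exact Real.exp_le_exp.2 (abs_le.1 (hD x)).2)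
  have hi2 : Integrable (fun x => Real.exp (-ψ x)) μ :=
    Integrable.of_bound (by fun_prop) (Real.exp C) (Eventually.of_forall fun x => by
      rw [Real.norm_of_nonneg (Real.exp_pos _).le]
      exact Real.exp_le_exp.2 (neg_le.1 (abs_le.1 (hC x)).1))
  rw [← ofReal_integral_eq_lintegral_ofReal hi1 (Eventually.of_forall fun x => (Real.exp_pos _).le),
    ← ofReal_integral_eq_lintegral_ofReal hi2 (Eventually.of_forall fun x => (Real.exp_pos _).le),
    ← ENNReal.ofReal_mul (integral_nonneg fun x => (Real.exp_pos _).le),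
    ENNReal.ofReal_le_one, ← integral_prod_mul] at h2
  simpa only [sub_eq_add_neg, Real.exp_add] using h2

/-- If `w 0 > 0`, there is an affine function `l + c ≤ w` with `l` linear and `c > 0`. Truncating
`l` at height `N + c` gives `ψ` with `ψ □ w ≥ ψ` everywhere and `ψ □ w ≥ ψ + c` on `{|l| ≤ N}`;
then (τ) and `exp s ≥ 1 + s` force `{|l| ≤ N}` to be null for every `N`, which is absurd. -/
theorem PropertyTau.apply_zero (hτ : PropertyTau μ w) (hw : ∀ x, 0 ≤ w x)
    (hconv : ConvexOn ℝ Set.univ w) : w 0 = 0 := by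
  by_contra hne
  have hpos : 0 < w 0 := lt_of_le_of_ne (hw 0) (Ne.symm hne)
  have hcont : Continuous w := continuousOn_univ.1 (hconv.continuousOn isOpen_univ)
  obtain ⟨l, c, hlc, hc⟩ := hconv.exists_affine_le_of_lt (𝕜 := ℝ) (x := 0) (a := w 0 / 2)
    (Set.mem_univ _) (by linarith) isClosed_univ (hcont.lowerSemicontinuous.lowerSemicontinuousOn _)
  have hlc' : ∀ y, l y + c ≤ w y := fun y => by simpa using hlc ⟨y, Set.mem_univ y⟩
  have hc0 : 0 < c := by simp at hc; linarith
  have hG : ∀ N : ℕ, μ {x | |l x| ≤ N} = 0 := by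
    intro N
    have hGm : MeasurableSet {x | |l x| ≤ N} := measurableSet_le (by fun_prop) (by fun_prop)
    set ψ : EuclideanSpace ℝ (Fin n) → ℝ := fun x => max (-(N + c)) (min (N + c) (l x)) with hψ
    set u : EuclideanSpace ℝ (Fin n) → ℝ :=
      fun x => ψ x + Set.indicator {x | |l x| ≤ N} (fun _ => c) x with hu
    have hψm : Measurable ψ := by fun_prop
    have hum : Measurable u := hψm.add (measurable_const.indicator hGm)
    have hN : (0 : ℝ) ≤ N := N.cast_nonneg
    have hψb : ∀ x, |ψ x| ≤ N + c := fun x => by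
      rw [abs_le]; simp only [hψ]; constructor
      · exact le_max_left _ _
      · exact max_le (by linarith) (min_le_left _ _)
    have hub : ∀ x, |u x| ≤ N + c + c := fun x => by
      refine (abs_add_le _ _).trans (add_le_add (hψb x) ?_)
      by_cases hx : x ∈ {x | |l x| ≤ N}
      · rw [Set.indicator_of_mem hx, abs_of_pos hc0]
      · rw [Set.indicator_of_notMem hx]; simpa using hc0.le
    have hle : ∀ x, u x ≤ infConv ψ w x := by
      intro x
      refine le_ciInf fun y => ?_
      have h1 := hlc' y
      have h2 := hw y
      by_cases hx : |l x| ≤ N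
      · simp only [hu, hψ, map_sub]
        rw [Set.indicator_of_mem (show x ∈ {x | |l x| ≤ N} from hx)]
        exact clamp_add_le hc0 hN (abs_le.1 hx).1 (abs_le.1 hx).2 h1 h2
      · simp only [hu, hψ, map_sub]
        rw [Set.indicator_of_notMem (show x ∉ {x | |l x| ≤ N} from hx), add_zero]
        exact clamp_le hc0 h1 h2
    have h1 := hτ.integral_exp_sub_le_one hψm hψb hum hub hle
    have hui : Integrable u μ := Integrable.of_bound hum.aestronglyMeasurable (N + c + c)
      (Eventually.of_forall hub)
    have hψi : Integrable ψ μ := Integrable.of_bound hψm.aestronglyMeasurable (N + c)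
      (Eventually.of_forall hψb)
    have hi : Integrable (fun z : EuclideanSpace ℝ (Fin n) × EuclideanSpace ℝ (Fin n) =>
        u z.1 - ψ z.2) (μ.prod μ) := (hui.comp_fst μ).sub (hψi.comp_snd μ)
    have hei : Integrable (fun z : EuclideanSpace ℝ (Fin n) × EuclideanSpace ℝ (Fin n) =>
        Real.exp (u z.1 - ψ z.2)) (μ.prod μ) :=
      Integrable.of_bound (by fun_prop) (Real.exp ((N + c + c) + (N + c)))
        (Eventually.of_forall fun z => by
          rw [Real.norm_of_nonneg (Real.exp_pos _).le]
          have := (abs_le.1 (hub z.1)).2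
          have := (abs_le.1 (hψb z.2)).1
          exact Real.exp_le_exp.2 (by linarith))
    have h2 : ∫ z, (u z.1 - ψ z.2 + 1) ∂(μ.prod μ) ≤ ∫ z, Real.exp (u z.1 - ψ z.2) ∂(μ.prod μ) :=
      integral_mono (hi.add (integrable_const 1)) hei fun z => Real.add_one_le_exp _
    rw [integral_add hi (integrable_const 1),
      integral_sub (hui.comp_fst μ) (hψi.comp_snd μ), integral_fun_fst u, integral_fun_snd ψ] at h2
    simp only [hu, probReal_univ, one_smul, integral_const] at h2
    rw [integral_add hψi ((integrable_const c).indicator hGm), integral_indicator_const _ hGm] at h2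
    have h3 : μ.real {x | |l x| ≤ N} * c ≤ 0 := by
      rw [smul_eq_mul] at h2
      exact by linarith [h2.trans h1]
    have h4 : μ.real {x | |l x| ≤ N} = 0 :=
      le_antisymm (by nlinarith) measureReal_nonneg
    exact (measureReal_eq_zero_iff).1 h4
  have huniv : (⋃ N : ℕ, {x | |l x| ≤ N}) = Set.univ := by
    ext x
    obtain ⟨N, hN⟩ := exists_nat_ge |l x|
    simpa using ⟨N, hN⟩
  have := measure_iUnion_null hG
  rw [huniv] at this
  simp at this

end PropertyTau

theorem two_add_sq_le_exp_add_exp_neg (u : ℝ) : 2 + u ^ 2 ≤ Real.exp u + Real.exp (-u) := by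
  have key : ∀ v : ℝ, 0 ≤ v → 2 + v ^ 2 ≤ Real.exp v + Real.exp (-v) := by
    intro v hv
    have h1 : v / 2 ≤ Real.sinh (v / 2) := Real.self_le_sinh_iff.2 (by positivity)
    have h2 : Real.exp v = Real.exp (v / 2) ^ 2 := by rw [← Real.exp_nat_mul]; ring_nf
    have h3 : Real.exp (-v) = Real.exp (-(v / 2)) ^ 2 := by rw [← Real.exp_nat_mul]; ring_nf
    have h4 : Real.exp (v / 2) * Real.exp (-(v / 2)) = 1 := by rw [← Real.exp_add]; simp
    rw [Real.sinh_eq] at h1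
    rw [h2, h3]
    nlinarith
  rcases le_total 0 u with h | h
  · exact key u h
  · have := key (-u) (by linarith)
    rw [neg_neg] at this
    linarith [neg_sq u]

section PropertyTau

variable {n : ℕ} {μ : Measure (EuclideanSpace ℝ (Fin n))} [IsProbabilityMeasure μ]
  {φ ψ w : EuclideanSpace ℝ (Fin n) → ℝ}

theorem integrable_exp_mul_sub_mul {C B : ℝ} (hψ : Measurable ψ)
    (hC : ∀ x, |ψ x| ≤ C) {F : EuclideanSpace ℝ (Fin n) → ℝ} (hF : Measurable F)
    (hFB : ∀ x, |F x| ≤ B) (t : ℝ) :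
    Integrable (fun z : EuclideanSpace ℝ (Fin n) × EuclideanSpace ℝ (Fin n) =>
      Real.exp (t * (ψ z.1 - ψ z.2)) * F z.1) (μ.prod μ) := by
  refine Integrable.of_bound (by fun_prop) (Real.exp (|t| * (C + C)) * B)
    (Eventually.of_forall fun z => ?_)
  rw [norm_mul, Real.norm_of_nonneg (Real.exp_pos _).le, Real.norm_eq_abs]
  refine mul_le_mul (Real.exp_le_exp.2 ((le_abs_self _).trans ?_)) (hFB _) (abs_nonneg _)
    (Real.exp_pos _).le
  rw [abs_mul]
  exact mul_le_mul_of_nonneg_left ((abs_sub _ _).trans (add_le_add (hC _) (hC _))) (abs_nonneg t)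

/-- The quantitative form of (τ) at a fixed `t`, for a function `F` measuring the loss in the
infimal convolution of `t ψ` with `w`. -/
theorem PropertyTau.half_integral_sq_le (hτ : PropertyTau μ w) {C B t : ℝ} (hψ : Measurable ψ)
    (hC : ∀ x, |ψ x| ≤ C) {F : EuclideanSpace ℝ (Fin n) → ℝ} (hF : Measurable F)
    (hFB : ∀ x, |F x| ≤ B) (ht : 0 < t)
    (h : ∀ x, t * ψ x - t ^ 2 * F x ≤ infConv (fun z => t * ψ z) w x) :
    (1 / 2 : ℝ) * ∫ z, (ψ z.1 - ψ z.2) ^ 2 ∂(μ.prod μ) ≤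
      ∫ z, Real.exp (t * (ψ z.1 - ψ z.2)) * F z.1 ∂(μ.prod μ) := by
  have hI := integrable_exp_mul_sub_mul (μ := μ) hψ hC hF hFB t
  have hJ : ∀ s : ℝ, Integrable (fun z : EuclideanSpace ℝ (Fin n) × EuclideanSpace ℝ (Fin n) =>
      Real.exp (s * (ψ z.1 - ψ z.2))) (μ.prod μ) := fun s => by
    simpa using integrable_exp_mul_sub_mul (μ := μ) hψ hC (F := fun _ => 1) measurable_const
      (B := 1) (by simp) s
  have h1 := hτ.integral_exp_sub_le_one (ψ := fun z => t * ψ z) (C := t * C) (by fun_prop)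
    (fun x => by rw [abs_mul, abs_of_pos ht]; exact mul_le_mul_of_nonneg_left (hC x) ht.le)
    (u := fun x => t * ψ x - t ^ 2 * F x) (by fun_prop) (D := t * C + t ^ 2 * B)
    (fun x => by
      refine (abs_sub _ _).trans (add_le_add ?_ ?_)
      · rw [abs_mul, abs_of_pos ht]; exact mul_le_mul_of_nonneg_left (hC x) ht.le
      · rw [abs_mul, abs_of_pos (by positivity)]
        exact mul_le_mul_of_nonneg_left (hFB x) (by positivity)) h
  have h2 : ∫ z, (Real.exp (t * (ψ z.1 - ψ z.2)) - t ^ 2 * (Real.exp (t * (ψ z.1 - ψ z.2)) * F z.1))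
      ∂(μ.prod μ) ≤ ∫ z, Real.exp (t * ψ z.1 - t ^ 2 * F z.1 - t * ψ z.2) ∂(μ.prod μ) := by
    refine integral_mono ((hJ t).sub (hI.const_mul _)) ?_ fun z => ?_
    · refine (integrable_exp_mul_sub_mul (μ := μ) hψ hC (F := fun x => Real.exp (-(t ^ 2 * F x)))
        (B := Real.exp (t ^ 2 * B)) (by fun_prop) (fun x => ?_) t).congr
        (Eventually.of_forall fun z => ?_)
      · rw [abs_of_pos (Real.exp_pos _), Real.exp_le_exp, ← mul_neg]
        exact mul_le_mul_of_nonneg_left (neg_le.1 (abs_le.1 (hFB x)).1) (by positivity)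
      · simp only [← Real.exp_add]
        ring_nf
    · have h3 := Real.add_one_le_exp (-(t ^ 2 * F z.1))
      have h4 : Real.exp (t * ψ z.1 - t ^ 2 * F z.1 - t * ψ z.2) =
          Real.exp (t * (ψ z.1 - ψ z.2)) * Real.exp (-(t ^ 2 * F z.1)) := by
        rw [← Real.exp_add]; ring_nf
      simp only
      rw [h4]
      nlinarith [mul_le_mul_of_nonneg_left h3 (Real.exp_pos (t * (ψ z.1 - ψ z.2))).le]
  rw [integral_sub (hJ t) (hI.const_mul _), integral_const_mul] at h2
  -- exchanging the two variables replaces `t` by `-t`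
  have h5 : ∫ z, Real.exp (-t * (ψ z.1 - ψ z.2)) ∂(μ.prod μ) =
      ∫ z, Real.exp (t * (ψ z.1 - ψ z.2)) ∂(μ.prod μ) := by
    rw [← integral_prod_swap]
    congr 1; ext z; simp only [Prod.fst_swap, Prod.snd_swap]; ring_nf
  have hΔ : Integrable (fun z : EuclideanSpace ℝ (Fin n) × EuclideanSpace ℝ (Fin n) =>
      (ψ z.1 - ψ z.2) ^ 2) (μ.prod μ) := by
    refine Integrable.of_bound (by fun_prop) ((C + C) ^ 2) (Eventually.of_forall fun z => ?_)
    rw [norm_pow, Real.norm_eq_abs]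
    exact pow_le_pow_left₀ (abs_nonneg _) ((abs_sub _ _).trans (add_le_add (hC _) (hC _))) 2
  have h6 : ∫ z, (2 + t ^ 2 * (ψ z.1 - ψ z.2) ^ 2) ∂(μ.prod μ) ≤
      ∫ z, (Real.exp (t * (ψ z.1 - ψ z.2)) + Real.exp (-t * (ψ z.1 - ψ z.2))) ∂(μ.prod μ) := by
    refine integral_mono ((integrable_const _).add (hΔ.const_mul _)) ((hJ t).add (hJ (-t)))
      fun z => ?_
    have := two_add_sq_le_exp_add_exp_neg (t * (ψ z.1 - ψ z.2))
    rw [mul_pow] at this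
    simpa only [neg_mul] using this
  rw [integral_add (integrable_const _) (hΔ.const_mul _), integral_add (hJ t) (hJ (-t)), h5,
    integral_const_mul] at h6
  simp only [integral_const, probReal_univ, one_smul] at h6
  refine le_of_mul_le_mul_left ?_ (show 0 < t ^ 2 by positivity)
  linarith [h2.trans h1]

/-- The left side involves a bounded function `ψ` whose increments are dominated by those of `φ`,
the right side the gradient of `φ`. In this form `ψ` may be a truncation of `φ`, which need not be
differentiable almost everywhere. -/
theorem PropertyTau.half_integral_sq_le_integral_gradient (hτ : PropertyTau μ w)
    (hw : ∀ x, 0 ≤ w x) (hconv : ConvexOn ℝ Set.univ w)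
    (hloc : ∀ᶠ x in 𝓝 (0 : EuclideanSpace ℝ (Fin n)), (1 / 4 : ℝ) * ‖x‖ ^ 2 ≤ w x)
    {K : ℝ≥0} (hφ : LipschitzWith K φ) (hd : ∀ᵐ x ∂μ, DifferentiableAt ℝ φ x)
    (hψφ : ∀ x y, |ψ x - ψ y| ≤ |φ x - φ y|) {C : ℝ} (hC : ∀ x, |ψ x| ≤ C) :
    (1 / 2 : ℝ) * ∫ z, (ψ z.1 - ψ z.2) ^ 2 ∂(μ.prod μ) ≤ ∫ x, ‖∇ φ x‖ ^ 2 ∂μ := by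
  have hw0 := hτ.apply_zero hw hconv
  have hψ : LipschitzWith K ψ := LipschitzWith.of_dist_le_mul fun x y => by
    rw [Real.dist_eq]
    exact (hψφ x y).trans (by rw [← Real.dist_eq]; exact hφ.dist_le_mul x y)
  have hψm : Measurable ψ := hψ.continuous.measurable
  obtain ⟨δ, hδ, hδw⟩ := Metric.eventually_nhds_iff.1 hloc
  have hball : ∀ r, r < δ → ∀ y : EuclideanSpace ℝ (Fin n), ‖y‖ ≤ r →
      (1 / 4 : ℝ) * ‖y‖ ^ 2 ≤ w y := fun r hr y hy =>
    hδw (by rw [dist_zero_right]; exact hy.trans_lt hr)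
  set t : ℕ → ℝ := fun k => 1 / ((k : ℝ) + 1) with ht
  have ht0 : ∀ k, 0 < t k := fun k => by positivity
  have htlim : Tendsto t atTop (𝓝 0) := tendsto_one_div_add_atTop_nhds_zero_nat
  have htsmall : ∀ r, 0 < r → ∀ᶠ k in atTop, t k * K ≤ r / 4 := fun r hr =>
    ((htlim.mul_const (K : ℝ)).eventually_le_const (by simpa using (by positivity : 0 < r / 4)))
  set Q : ℕ → EuclideanSpace ℝ (Fin n) → ℝ := fun k => infConv (fun z => t k * ψ z) w with hQ
  have hQm : ∀ k, Measurable (Q k) := fun k => by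
    have hl : LipschitzWith ((t k).toNNReal * K) (fun z => t k * ψ z) :=
      LipschitzWith.of_dist_le_mul fun x y => by
        rw [Real.dist_eq, ← mul_sub, abs_mul, abs_of_pos (ht0 k), NNReal.coe_mul,
          Real.coe_toNNReal _ (ht0 k).le, mul_assoc]
        exact mul_le_mul_of_nonneg_left (hψ.dist_le_mul x y) (ht0 k).le
    exact (lipschitzWith_infConv hl (C := -(t k * C)) (fun x => by
      rw [← mul_neg]
      exact mul_le_mul_of_nonneg_left (abs_le.1 (hC x)).1 (ht0 k).le) hw).continuous.measurable
  -- the normalized loss; the maximum with `‖∇ φ‖²` makes it nonnegative and turns an upper bound on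
  -- the limit superior into convergence
  set G : ℕ → EuclideanSpace ℝ (Fin n) → ℝ :=
    fun k x => max ((t k * ψ x - Q k x) / t k ^ 2) (‖∇ φ x‖ ^ 2) with hG
  have hGm : ∀ k, Measurable (G k) := fun k =>
    (((hψm.const_mul _).sub (hQm k)).div_const _).max ((measurable_gradient φ).norm.pow_const 2)
  have hG0 : ∀ k x, 0 ≤ G k x := fun k x => le_max_of_le_right (by positivity)
  have hGQ : ∀ k x, t k * ψ x - t k ^ 2 * G k x ≤ Q k x := fun k x => by
    have h1 : (t k * ψ x - Q k x) / t k ^ 2 ≤ G k x := le_max_left _ _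
    rw [div_le_iff₀ (by have := ht0 k; positivity)] at h1
    linarith
  have hGle : ∀ k x r L, 0 < r → r < δ → t k * K ≤ r / 4 →
      (∀ y, ‖y‖ ≤ r → |ψ (x - y) - ψ x| ≤ L * ‖y‖) → (t k * ψ x - Q k x) / t k ^ 2 ≤ L ^ 2 := by
    intro k x r L hr hrδ hk hL
    have := le_infConv_of_local hconv hw0 hr (hball r hrδ) hψ (ht0 k).le hk hL
    rw [div_le_iff₀ (by have := ht0 k; positivity)]
    linarith
  have hGK : ∀ᶠ k in atTop, ∀ x, G k x ≤ (K : ℝ) ^ 2 := by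
    filter_upwards [htsmall (δ / 2) (by positivity)] with k hk x
    refine max_le (hGle k x (δ / 2) K (by positivity) (by linarith) hk fun y _ => ?_)
      (pow_le_pow_left₀ (norm_nonneg _) (hφ.norm_gradient_le x) 2)
    have := hψ.dist_le_mul (x - y) x
    rwa [Real.dist_eq, dist_eq_norm, sub_sub_cancel_left, norm_neg] at this
  have hGlim : ∀ x, DifferentiableAt ℝ φ x → Tendsto (fun k => G k x) atTop (𝓝 (‖∇ φ x‖ ^ 2)) := by
    intro x hx
    have hnorm : ‖fderiv ℝ φ x‖ = ‖∇ φ x‖ := by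
      rw [gradient, LinearIsometryEquiv.norm_map]
    have hup : ∀ ε : ℝ, 0 < ε → ∀ᶠ k in atTop, G k x ≤ (‖∇ φ x‖ + ε) ^ 2 := by
      intro ε hε
      have h1 := (hasFDerivAt_iff_isLittleO_nhds_zero.1 hx.hasFDerivAt).def hε
      obtain ⟨ρ, hρ, hρφ⟩ := Metric.eventually_nhds_iff.1 h1
      have hr : 0 < min (ρ / 2) (δ / 2) := by positivity
      filter_upwards [htsmall _ hr] with k hk
      refine max_le (hGle k x _ _ hr ((min_le_right _ _).trans_lt (by linarith)) hk
        fun y hy => ?_) (pow_le_pow_left₀ (norm_nonneg _) (by linarith) 2)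
      have h2 : ‖φ (x + -y) - φ x - (fderiv ℝ φ x) (-y)‖ ≤ ε * ‖-y‖ := hρφ (by
        rw [dist_zero_right, norm_neg]
        exact (hy.trans (min_le_left _ _)).trans_lt (by linarith))
      have h3 := (fderiv ℝ φ x).le_opNorm (-y)
      rw [hnorm] at h3
      rw [← sub_eq_add_neg] at h2
      rw [norm_neg] at h2 h3
      calc |ψ (x - y) - ψ x| ≤ |φ (x - y) - φ x| := hψφ _ _
        _ = ‖(φ (x - y) - φ x - (fderiv ℝ φ x) (-y)) + (fderiv ℝ φ x) (-y)‖ := by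
            rw [sub_add_cancel, Real.norm_eq_abs]
        _ ≤ _ := norm_add_le _ _
        _ ≤ (‖∇ φ x‖ + ε) * ‖y‖ := by linarith
    refine tendsto_order.2 ⟨fun a ha => Eventually.of_forall fun k =>
      ha.trans_le (le_max_right _ _), fun a ha => ?_⟩
    have hc : Tendsto (fun ε : ℝ => (‖∇ φ x‖ + ε) ^ 2) (𝓝[>] 0) (𝓝 (‖∇ φ x‖ ^ 2)) := by
      have : Continuous fun ε : ℝ => (‖∇ φ x‖ + ε) ^ 2 := by fun_prop
      simpa using (this.tendsto 0).mono_left nhdsWithin_le_nhds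
    obtain ⟨ε, hεa, hε⟩ := ((hc.eventually_lt_const ha).and self_mem_nhdsWithin).exists
    filter_upwards [hup ε hε] with k hk
    exact hk.trans_lt hεa
  have hineq : ∀ᶠ k in atTop, (1 / 2 : ℝ) * ∫ z, (ψ z.1 - ψ z.2) ^ 2 ∂(μ.prod μ) ≤
      ∫ z, Real.exp (t k * (ψ z.1 - ψ z.2)) * G k z.1 ∂(μ.prod μ) := by
    filter_upwards [hGK] with k hk
    exact hτ.half_integral_sq_le hψm hC (hGm k) (B := (K : ℝ) ^ 2)
      (fun x => by rw [abs_of_nonneg (hG0 k x)]; exact hk x) (ht0 k) (hGQ k)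
  have hlim : Tendsto (fun k => ∫ z, Real.exp (t k * (ψ z.1 - ψ z.2)) * G k z.1 ∂(μ.prod μ)) atTop
      (𝓝 (∫ z : EuclideanSpace ℝ (Fin n) × EuclideanSpace ℝ (Fin n), ‖∇ φ z.1‖ ^ 2
        ∂(μ.prod μ))) := by
    refine tendsto_integral_filter_of_dominated_convergence
      (fun _ => Real.exp (C + C) * (K : ℝ) ^ 2) (Eventually.of_forall fun k => ?_) ?_
      (integrable_const _) ?_
    · have := hGm k
      exact Measurable.aestronglyMeasurable (by fun_prop)
    · filter_upwards [hGK] with k hk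
      refine Eventually.of_forall fun z => ?_
      rw [norm_mul, Real.norm_of_nonneg (Real.exp_pos _).le, Real.norm_of_nonneg (hG0 _ _)]
      have h1 : |ψ z.1 - ψ z.2| ≤ C + C := (abs_sub _ _).trans (add_le_add (hC _) (hC _))
      have h2 : t k ≤ 1 := by
        rw [ht]; simp only; rw [div_le_one (by positivity)]; linarith [k.cast_nonneg (α := ℝ)]
      gcongr
      · calc t k * (ψ z.1 - ψ z.2) ≤ t k * |ψ z.1 - ψ z.2| :=
              mul_le_mul_of_nonneg_left (le_abs_self _) (ht0 k).le
          _ ≤ 1 * |ψ z.1 - ψ z.2| := mul_le_mul_of_nonneg_right h2 (abs_nonneg _)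
          _ ≤ C + C := by rwa [one_mul]
      · exact hk _
    · filter_upwards [Measure.quasiMeasurePreserving_fst.ae hd] with z hz
      have h1 : Tendsto (fun k => Real.exp (t k * (ψ z.1 - ψ z.2))) atTop (𝓝 1) := by
        have := (Real.continuous_exp.tendsto _).comp (htlim.mul_const (ψ z.1 - ψ z.2))
        simpa [Function.comp_def] using this
      simpa using h1.mul (hGlim z.1 hz)
  rw [integral_fun_fst (fun x => ‖∇ φ x‖ ^ 2)] at hlim
  simpa using ge_of_tendsto hlim hineq

theorem PropertyTau.poincareIneq (hτ : PropertyTau μ w)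
    (hw : ∀ x, 0 ≤ w x) (hconv : ConvexOn ℝ Set.univ w)
    (hloc : ∀ᶠ x in 𝓝 (0 : EuclideanSpace ℝ (Fin n)), (1 / 4 : ℝ) * ‖x‖ ^ 2 ≤ w x)
    {K : ℝ≥0} (hφ : LipschitzWith K φ) (hd : ∀ᵐ x ∂μ, DifferentiableAt ℝ φ x) :
    PoincareIneq μ φ := by
  have hφm : Measurable φ := hφ.continuous.measurable
  set ψ : ℕ → EuclideanSpace ℝ (Fin n) → ℝ := fun N x => max (-(N : ℝ)) (min N (φ x)) with hψ
  have hψm : ∀ N, Measurable (ψ N) := fun N => by fun_prop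
  have hψb : ∀ N x, |ψ N x| ≤ N := fun N x => abs_le.2
    ⟨le_max_left _ _, max_le (by linarith [N.cast_nonneg (α := ℝ)]) (min_le_left _ _)⟩
  have hψφ : ∀ N x y, |ψ N x - ψ N y| ≤ |φ x - φ y| := fun N x y => by
    have h1 := abs_max_sub_max_le_abs (min (N : ℝ) (φ x)) (min N (φ y)) (-(N : ℝ))
    rw [max_comm, max_comm (min (N : ℝ) (φ y))] at h1
    exact h1.trans (by simpa using abs_min_sub_min_le_max (N : ℝ) (φ x) N (φ y))
  have hψlim : ∀ x, Tendsto (fun N => ψ N x) atTop (𝓝 (φ x)) := fun x => by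
    obtain ⟨M, hM⟩ := exists_nat_ge |φ x|
    refine tendsto_const_nhds.congr' ?_
    filter_upwards [eventually_ge_atTop M] with N hN
    have h1 := abs_le.1 (hM.trans (Nat.cast_le.2 hN))
    simp only [hψ]
    rw [min_eq_right h1.2, max_eq_right h1.1]
  refine poincareIneq_of_lintegral_le hφ ?_
  have hbound : ∀ N, ∫⁻ z, ENNReal.ofReal ((ψ N z.1 - ψ N z.2) ^ 2) ∂(μ.prod μ) ≤
      ENNReal.ofReal (2 * ∫ x, ‖∇ φ x‖ ^ 2 ∂μ) := by
    intro N
    have h1 := hτ.half_integral_sq_le_integral_gradient hw hconv hloc hφ hd (hψφ N) (hψb N)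
    have hi : Integrable (fun z : EuclideanSpace ℝ (Fin n) × EuclideanSpace ℝ (Fin n) =>
        (ψ N z.1 - ψ N z.2) ^ 2) (μ.prod μ) := by
      have := hψm N
      refine Integrable.of_bound (Measurable.aestronglyMeasurable (by fun_prop))
        ((N + N : ℝ) ^ 2) (Eventually.of_forall fun z => ?_)
      rw [norm_pow, Real.norm_eq_abs]
      exact pow_le_pow_left₀ (abs_nonneg _)
        ((abs_sub _ _).trans (add_le_add (hψb N _) (hψb N _))) 2
    rw [← ofReal_integral_eq_lintegral_ofReal hi (Eventually.of_forall fun z => by positivity)]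
    exact ENNReal.ofReal_le_ofReal (by linarith)
  have hlim : ∀ z : EuclideanSpace ℝ (Fin n) × EuclideanSpace ℝ (Fin n),
      Tendsto (fun N => ENNReal.ofReal ((ψ N z.1 - ψ N z.2) ^ 2)) atTop
        (𝓝 (ENNReal.ofReal ((φ z.1 - φ z.2) ^ 2))) := fun z =>
    (ENNReal.continuous_ofReal.tendsto _).comp (((hψlim z.1).sub (hψlim z.2)).pow 2)
  calc ∫⁻ z, ENNReal.ofReal ((φ z.1 - φ z.2) ^ 2) ∂(μ.prod μ)
      = ∫⁻ z, liminf (fun N => ENNReal.ofReal ((ψ N z.1 - ψ N z.2) ^ 2)) atTop ∂(μ.prod μ) :=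
        lintegral_congr fun z => (hlim z).liminf_eq.symm
    _ ≤ liminf (fun N => ∫⁻ z, ENNReal.ofReal ((ψ N z.1 - ψ N z.2) ^ 2) ∂(μ.prod μ)) atTop :=
        lintegral_liminf_le fun N => by have := hψm N; fun_prop
    _ ≤ liminf (fun _ : ℕ => ENNReal.ofReal (2 * ∫ x, ‖∇ φ x‖ ^ 2 ∂μ)) atTop :=
        liminf_le_liminf (Eventually.of_forall hbound)
    _ = _ := liminf_const _

end PropertyTau

/-! ### The one-dimensional Gaussian Poincaré inequality -/

/-- The Cauchy-Schwarz inequality for `f x - f y = ∫_y^x f'`. -/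
theorem LipschitzWith.sq_sub_le_mul_lintegral_deriv {f : ℝ → ℝ} {K : ℝ≥0}
    (hf : LipschitzWith K f) {x y : ℝ} (hyx : y ≤ x) :
    ENNReal.ofReal ((f x - f y) ^ 2) ≤
      ENNReal.ofReal (x - y) * ∫⁻ s in Set.Ioc y x, ENNReal.ofReal (deriv f s ^ 2) := by
  have hb : ∀ s, |deriv f s| ≤ K := fun s => norm_deriv_le_of_lipschitz hf
  have hm : Measurable (deriv f) := measurable_deriv f
  have hi1 : IntegrableOn (deriv f) (Set.Ioc y x) :=
    Integrable.of_bound hm.aestronglyMeasurable (K : ℝ) (Eventually.of_forall hb)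
  have hi2 : IntegrableOn (fun s => deriv f s ^ 2) (Set.Ioc y x) :=
    Integrable.of_bound (hm.pow_const 2).aestronglyMeasurable ((K : ℝ) ^ 2)
      (Eventually.of_forall fun s => by
        rw [norm_pow]; exact pow_le_pow_left₀ (norm_nonneg _) (hb s) 2)
  have hftc : ∫ s in Set.Ioc y x, deriv f s = f x - f y := by
    rw [← intervalIntegral.integral_of_le hyx]
    exact (hf.lipschitzOnWith.absolutelyContinuousOnInterval).integral_deriv_eq_sub
  have hvar : ∀ m : ℝ, 0 ≤ (x - y) * (m * m) + (-2 * (f x - f y)) * m +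
      ∫ s in Set.Ioc y x, deriv f s ^ 2 := by
    intro m
    have h0 : 0 ≤ ∫ s in Set.Ioc y x, (m * m + -2 * m * deriv f s + deriv f s ^ 2) :=
      integral_nonneg fun s => by simp only [Pi.zero_apply]; nlinarith [sq_nonneg (m - deriv f s)]
    have hc : IntegrableOn (fun _ : ℝ => m * m) (Set.Ioc y x) := integrable_const _
    have hc' : IntegrableOn (fun s : ℝ => -2 * m * deriv f s) (Set.Ioc y x) := hi1.const_mul _
    have hcc : IntegrableOn (fun s : ℝ => m * m + -2 * m * deriv f s) (Set.Ioc y x) := hc.add hc'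
    rw [integral_add hcc hi2, integral_add hc hc', integral_const_mul (-2 * m), hftc,
      setIntegral_const, Measure.real, Real.volume_Ioc, ENNReal.toReal_ofReal (by linarith),
      smul_eq_mul] at h0
    linarith
  -- the polynomial `m ↦ ∫_y^x (m - f')²` is nonnegative
  have hdisc := discrim_le_zero hvar
  rw [discrim] at hdisc
  rw [← ofReal_integral_eq_lintegral_ofReal hi2 (Eventually.of_forall fun s => sq_nonneg _),
    ← ENNReal.ofReal_mul (by linarith)]
  exact ENNReal.ofReal_le_ofReal (by linarith)

theorem hasDerivAt_neg_gaussianPDFReal (x : ℝ) :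
    HasDerivAt (fun x => -gaussianPDFReal 0 1 x) (gaussianPDFReal 0 1 x * x) x := by
  simp only [gaussianPDFReal_def, NNReal.coe_one, mul_one, sub_zero]
  have h1 : HasDerivAt (fun x : ℝ => -x ^ 2 / 2) (-x) x := by
    convert! ((hasDerivAt_pow 2 x).neg.div_const 2) using 1
    push_cast
    ring
  convert! (h1.exp.const_mul (√(2 * Real.pi))⁻¹).neg using 1
  ring

theorem integrable_gaussianPDFReal_mul_self :
    Integrable (fun x => gaussianPDFReal 0 1 x * x) := by
  have := (integrable_mul_exp_neg_mul_sq (b := 1 / 2) (by norm_num)).const_mul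
    (√(2 * Real.pi))⁻¹
  refine this.congr (Eventually.of_forall fun x => ?_)
  simp only [gaussianPDFReal_def, NNReal.coe_one, mul_one, sub_zero]
  ring_nf

theorem tendsto_gaussianPDFReal_atTop : Tendsto (gaussianPDFReal 0 1) atTop (𝓝 0) := by
  simp only [gaussianPDFReal_def, NNReal.coe_one, mul_one, sub_zero]
  rw [← mul_zero (√(2 * Real.pi))⁻¹]
  refine (Real.tendsto_exp_atBot.comp ?_).const_mul _
  have h : Tendsto (fun x : ℝ => x ^ 2 / 2) atTop atTop :=
    (tendsto_pow_atTop two_ne_zero).atTop_div_const two_pos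
  simpa only [neg_div, Function.comp_def] using tendsto_neg_atTop_atBot.comp h

theorem setIntegral_Ici_id_gaussianReal (s : ℝ) :
    ∫ x in Set.Ici s, x ∂(gaussianReal 0 1) = gaussianPDFReal 0 1 s := by
  rw [← integral_indicator measurableSet_Ici,
    integral_gaussianReal_eq_integral_smul one_ne_zero]
  have h : ∀ x : ℝ, gaussianPDFReal 0 1 x • (Set.Ici s).indicator (fun x => x) x =
      (Set.Ici s).indicator (fun x => gaussianPDFReal 0 1 x * x) x := fun x => by
    by_cases hx : x ∈ Set.Ici s <;> simp [hx]
  simp_rw [h]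
  rw [integral_indicator measurableSet_Ici, integral_Ici_eq_integral_Ioi,
    integral_Ioi_of_hasDerivAt_of_tendsto' (fun x _ => hasDerivAt_neg_gaussianPDFReal x)
      integrable_gaussianPDFReal_mul_self.integrableOn
      (by simpa using tendsto_gaussianPDFReal_atTop.neg)]
  ring

theorem integrable_id_gaussianReal_std : Integrable (fun x : ℝ => x) (gaussianReal 0 1) :=
  IsGaussian.integrable_id

theorem setIntegral_Iio_id_gaussianReal (s : ℝ) :
    ∫ x in Set.Iio s, x ∂(gaussianReal 0 1) = -gaussianPDFReal 0 1 s := by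
  have h := integral_add_compl (measurableSet_Ici (a := s)) integrable_id_gaussianReal_std
  rw [setIntegral_Ici_id_gaussianReal, Set.compl_Ici, integral_id_gaussianReal] at h
  linarith

/-- The length of the segment from `z.2` to `z.1` if it crosses `s` upwards, and `0` otherwise. The
half-open convention `z.2 < s ≤ z.1` matches `Set.Ioc`. -/
noncomputable def crossingKernel (s : ℝ) (z : ℝ × ℝ) : ℝ≥0∞ :=
  if z.2 < s ∧ s ≤ z.1 then ENNReal.ofReal (z.1 - z.2) else 0

theorem measurable_crossingKernel :
    Measurable fun p : ℝ × (ℝ × ℝ) => crossingKernel p.1 p.2 := by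
  refine Measurable.ite ?_ (by fun_prop) measurable_const
  exact (measurableSet_lt (measurable_snd.comp measurable_snd) measurable_fst).inter
    (measurableSet_le measurable_fst (measurable_fst.comp measurable_snd))

/-- The mean of `(X - Y) 1_{Y < s ≤ X}` factorizes as
`E[X 1_{s ≤ X}] P(Y < s) - P(s ≤ X) E[Y 1_{Y < s}]`, and both truncated means are, up to sign, the
density at `s`. -/
theorem lintegral_crossingKernel (s : ℝ) :
    ∫⁻ z, crossingKernel s z ∂((gaussianReal 0 1).prod (gaussianReal 0 1)) =
      gaussianPDF 0 1 s := by
  have hid := integrable_id_gaussianReal_std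
  have hi1 : Integrable (fun z : ℝ × ℝ =>
      (Set.Ici s).indicator (fun x => x) z.1 * (Set.Iio s).indicator (fun _ => (1 : ℝ)) z.2)
      ((gaussianReal 0 1).prod (gaussianReal 0 1)) :=
    (hid.indicator measurableSet_Ici).mul_prod
      ((integrable_const (1 : ℝ)).indicator measurableSet_Iio)
  have hi2 : Integrable (fun z : ℝ × ℝ =>
      (Set.Ici s).indicator (fun _ => (1 : ℝ)) z.1 * (Set.Iio s).indicator (fun x => x) z.2)
      ((gaussianReal 0 1).prod (gaussianReal 0 1)) :=
    ((integrable_const (1 : ℝ)).indicator measurableSet_Ici).mul_prod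
      (hid.indicator measurableSet_Iio)
  have hnn : ∀ z : ℝ × ℝ, 0 ≤ (Set.Ici s).indicator (fun x => x) z.1 *
      (Set.Iio s).indicator (fun _ => (1 : ℝ)) z.2 -
      (Set.Ici s).indicator (fun _ => (1 : ℝ)) z.1 * (Set.Iio s).indicator (fun x => x) z.2 := by
    intro z
    by_cases h1 : s ≤ z.1 <;> by_cases h2 : z.2 < s <;> simp [Set.indicator, h1, h2]
    linarith
  have heq : ∀ z : ℝ × ℝ, crossingKernel s z = ENNReal.ofReal (
      (Set.Ici s).indicator (fun x => x) z.1 * (Set.Iio s).indicator (fun _ => (1 : ℝ)) z.2 -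
      (Set.Ici s).indicator (fun _ => (1 : ℝ)) z.1 * (Set.Iio s).indicator (fun x => x) z.2) := by
    intro z
    by_cases h1 : s ≤ z.1 <;> by_cases h2 : z.2 < s <;>
      simp [crossingKernel, Set.indicator, h1, h2]
  simp_rw [heq]
  have hi3 : Integrable (fun z : ℝ × ℝ => (Set.Ici s).indicator (fun x => x) z.1 *
      (Set.Iio s).indicator (fun _ => (1 : ℝ)) z.2 -
      (Set.Ici s).indicator (fun _ => (1 : ℝ)) z.1 * (Set.Iio s).indicator (fun x => x) z.2)
      ((gaussianReal 0 1).prod (gaussianReal 0 1)) := hi1.sub hi2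
  rw [← ofReal_integral_eq_lintegral_ofReal hi3 (Eventually.of_forall hnn),
    integral_sub hi1 hi2, integral_prod_mul, integral_prod_mul,
    integral_indicator measurableSet_Ici, integral_indicator measurableSet_Iio,
    integral_indicator measurableSet_Ici, integral_indicator measurableSet_Iio,
    setIntegral_Ici_id_gaussianReal, setIntegral_Iio_id_gaussianReal, gaussianPDF]
  have h := integral_add_compl (measurableSet_Ici (a := s))
    (integrable_const (μ := gaussianReal 0 1) (1 : ℝ))
  rw [Set.compl_Ici] at h
  simp only [integral_const, probReal_univ, smul_eq_mul, mul_one] at h ⊢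
  congr 1
  linear_combination (gaussianPDFReal 0 1 s) * h

/-- The one-dimensional Gaussian Poincaré inequality, in its sharp form. -/
theorem LipschitzWith.lintegral_sq_sub_gaussianReal_le {f : ℝ → ℝ} {K : ℝ≥0}
    (hf : LipschitzWith K f) :
    ∫⁻ z, ENNReal.ofReal ((f z.1 - f z.2) ^ 2) ∂((gaussianReal 0 1).prod (gaussianReal 0 1)) ≤
      2 * ∫⁻ s, ENNReal.ofReal (deriv f s ^ 2) ∂(gaussianReal 0 1) := by
  have hm : Measurable (deriv f) := measurable_deriv f
  have hk := measurable_crossingKernel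
  have hM : Measurable fun p : (ℝ × ℝ) × ℝ =>
      crossingKernel p.2 p.1 * ENNReal.ofReal (deriv f p.2 ^ 2) :=
    (hk.comp measurable_swap).mul (by fun_prop)
  set A : ℝ × ℝ → ℝ≥0∞ :=
    fun z => ∫⁻ s, crossingKernel s z * ENNReal.ofReal (deriv f s ^ 2) with hA
  have hAm : Measurable A := hM.lintegral_prod_right'
  have hle : ∀ x y, y ≤ x → ENNReal.ofReal ((f x - f y) ^ 2) ≤ A (x, y) := by
    intro x y hyx
    refine (hf.sq_sub_le_mul_lintegral_deriv hyx).trans_eq ?_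
    rw [← lintegral_const_mul _ (by fun_prop), ← lintegral_indicator measurableSet_Ioc]
    refine lintegral_congr fun s => ?_
    by_cases hs : y < s ∧ s ≤ x <;> simp [crossingKernel, Set.indicator, hs]
  have hle2 : ∀ z : ℝ × ℝ, ENNReal.ofReal ((f z.1 - f z.2) ^ 2) ≤ A z + A z.swap := by
    intro z
    rcases le_total z.2 z.1 with h | h
    · exact (hle z.1 z.2 h).trans le_self_add
    · rw [← neg_sub, neg_sq]
      exact (hle z.2 z.1 h).trans le_add_self
  have hAint : ∫⁻ z, A z ∂((gaussianReal 0 1).prod (gaussianReal 0 1)) =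
      ∫⁻ s, ENNReal.ofReal (deriv f s ^ 2) ∂(gaussianReal 0 1) := by
    rw [hA, lintegral_lintegral_swap hM.aemeasurable, gaussianReal_of_var_ne_zero _ one_ne_zero,
      lintegral_withDensity_eq_lintegral_mul _ (measurable_gaussianPDF 0 1) (by fun_prop),
      ← gaussianReal_of_var_ne_zero _ one_ne_zero]
    refine lintegral_congr fun s => ?_
    have hks : Measurable (crossingKernel s) := hk.comp measurable_prodMk_left
    rw [lintegral_mul_const _ hks, lintegral_crossingKernel]
    rfl
  calc _ ≤ ∫⁻ z, (A z + A z.swap) ∂((gaussianReal 0 1).prod (gaussianReal 0 1)) :=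
        lintegral_mono hle2
    _ = _ := by
        rw [lintegral_add_left hAm, lintegral_prod_swap, hAint, two_mul]

/-! ### Tensorization -/

/-- Subadditivity of the energy `∫ (g - g ∘ S)²`. It is the integral of the pointwise bound
`(a - d)² + (b - c)² ≤ (a - b)² + (c - d)² + (a - c)² + (b - d)²`, whose defect is
`(a - b - c + d)²`, for the values `a, b, c, d` of `g` at `ω, S ω, T ω, S (T ω)`: by
invariance the terms on each side are equal in pairs. -/
theorem MeasureTheory.MeasurePreserving.lintegral_sq_sub_comp_comp_le {Ω : Type*}
    [MeasurableSpace Ω] {P : Measure Ω} {S T : Ω → Ω} (hS : MeasurePreserving S P P)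
    (hT : MeasurePreserving T P P) (hSS : ∀ ω, S (S ω) = ω)
    (hST : ∀ ω, S (T ω) = T (S ω)) {g : Ω → ℝ} (hg : Measurable g) :
    ∫⁻ ω, ENNReal.ofReal ((g ω - g (S (T ω))) ^ 2) ∂P ≤
      ∫⁻ ω, ENNReal.ofReal ((g ω - g (S ω)) ^ 2) ∂P +
        ∫⁻ ω, ENNReal.ofReal ((g ω - g (T ω)) ^ 2) ∂P := by
  have hSm := hS.measurable
  have hTm := hT.measurable
  have h1 : ∫⁻ ω, ENNReal.ofReal ((g (S ω) - g (T ω)) ^ 2) ∂P =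
      ∫⁻ ω, ENNReal.ofReal ((g ω - g (S (T ω))) ^ 2) ∂P := by
    rw [← hS.lintegral_comp (f := fun ω => ENNReal.ofReal ((g ω - g (S (T ω))) ^ 2))
      (by fun_prop)]
    simp_rw [← hST, hSS]
  have h2 : ∫⁻ ω, ENNReal.ofReal ((g (T ω) - g (S (T ω))) ^ 2) ∂P =
      ∫⁻ ω, ENNReal.ofReal ((g ω - g (S ω)) ^ 2) ∂P :=
    hT.lintegral_comp (f := fun ω => ENNReal.ofReal ((g ω - g (S ω)) ^ 2)) (by fun_prop)
  have h3 : ∫⁻ ω, ENNReal.ofReal ((g (S ω) - g (S (T ω))) ^ 2) ∂P =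
      ∫⁻ ω, ENNReal.ofReal ((g ω - g (T ω)) ^ 2) ∂P := by
    simp_rw [hST]
    exact hS.lintegral_comp (f := fun ω => ENNReal.ofReal ((g ω - g (T ω)) ^ 2)) (by fun_prop)
  have hpt : ∀ ω, ENNReal.ofReal ((g ω - g (S (T ω))) ^ 2) +
      ENNReal.ofReal ((g (S ω) - g (T ω)) ^ 2) ≤
      (ENNReal.ofReal ((g ω - g (S ω)) ^ 2) + ENNReal.ofReal ((g (T ω) - g (S (T ω))) ^ 2)) +
      (ENNReal.ofReal ((g ω - g (T ω)) ^ 2) + ENNReal.ofReal ((g (S ω) - g (S (T ω))) ^ 2)) := by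
    intro ω
    rw [← ENNReal.ofReal_add (by positivity) (by positivity),
      ← ENNReal.ofReal_add (by positivity) (by positivity),
      ← ENNReal.ofReal_add (by positivity) (by positivity),
      ← ENNReal.ofReal_add (by positivity) (by positivity)]
    refine ENNReal.ofReal_le_ofReal ?_
    nlinarith [sq_nonneg (g ω - g (S ω) - g (T ω) + g (S (T ω)))]
  have h := lintegral_mono hpt (μ := P)
  rw [lintegral_add_left (by fun_prop), lintegral_add_left (by fun_prop),
    lintegral_add_left (by fun_prop), lintegral_add_left (by fun_prop), h1, h2, h3,
    ← two_mul, ← two_mul, ← two_mul, ← mul_add] at h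
  exact (ENNReal.mul_le_mul_iff_right two_ne_zero ENNReal.ofNat_ne_top).1 h

section Tensorization

variable {ι α : Type*} [DecidableEq ι]

/-- For `ω` encoding two points of `ι → α`, exchange their coordinates in `s`. -/
def swapOn (s : Finset ι) (ω : ι → α × α) : ι → α × α :=
  fun j => if j ∈ s then (ω j).swap else ω j

theorem swapOn_swapOn (s : Finset ι) (ω : ι → α × α) : swapOn s (swapOn s ω) = ω := by
  ext1 j
  by_cases h : j ∈ s <;> simp [swapOn, h]

theorem swapOn_comm (s t : Finset ι) (ω : ι → α × α) :
    swapOn s (swapOn t ω) = swapOn t (swapOn s ω) := by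
  ext1 j
  by_cases h : j ∈ s <;> by_cases h' : j ∈ t <;> simp [swapOn, h, h']

theorem swapOn_insert {s : Finset ι} {i : ι} (hi : i ∉ s) (ω : ι → α × α) :
    swapOn (insert i s) ω = swapOn {i} (swapOn s ω) := by
  ext1 j
  by_cases h : j = i
  · subst h; simp [swapOn, hi]
  · simp [swapOn, h]

variable [Fintype ι] [MeasurableSpace α]

theorem measurePreserving_swapOn (ν : Measure α) [SigmaFinite ν] (s : Finset ι) :
    MeasurePreserving (swapOn s) (Measure.pi fun _ : ι => ν.prod ν)
      (Measure.pi fun _ : ι => ν.prod ν) := by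
  have h := measurePreserving_pi (fun _ : ι => ν.prod ν) (fun _ : ι => ν.prod ν)
    (f := fun j p => if j ∈ s then p.swap else p) (fun j => by
      by_cases h : j ∈ s
      · simpa [h] using Measure.measurePreserving_swap (μ := ν) (ν := ν)
      · simpa [h, Function.id_def] using MeasurePreserving.id (ν.prod ν))
  exact h

theorem lintegral_sq_sub_swapOn_le (ν : Measure α) [SigmaFinite ν] {g : (ι → α × α) → ℝ}
    (hg : Measurable g) (s : Finset ι) :
    ∫⁻ ω, ENNReal.ofReal ((g ω - g (swapOn s ω)) ^ 2) ∂(Measure.pi fun _ : ι => ν.prod ν) ≤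
      ∑ i ∈ s, ∫⁻ ω, ENNReal.ofReal ((g ω - g (swapOn {i} ω)) ^ 2)
        ∂(Measure.pi fun _ : ι => ν.prod ν) := by
  induction s using Finset.induction_on with
  | empty =>
    have h : ∀ ω : ι → α × α, swapOn ∅ ω = ω := fun ω => by ext1 j; simp [swapOn]
    simp [h]
  | insert i s hi ih =>
    rw [Finset.sum_insert hi]
    simp_rw [swapOn_insert hi]
    exact ((measurePreserving_swapOn ν {i}).lintegral_sq_sub_comp_comp_le
      (measurePreserving_swapOn ν s) (swapOn_swapOn _) (swapOn_comm _ _) hg).trans (by gcongr)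

/-- Tensorization of the Poincaré inequality: if `f` satisfies it in each variable separately, with
`h i` in the role of the square of the `i`-th derivative, then `f` satisfies it for the product
measure, with the same constant. -/
theorem lintegral_sq_sub_pi_le (ν : Measure α) [IsProbabilityMeasure ν] {f : (ι → α) → ℝ}
    (hf : Measurable f) {h : ι → (ι → α) → ℝ≥0∞} (hh : ∀ i, Measurable (h i)) {c : ℝ≥0∞}
    (H : ∀ i x, ∫⁻ p, ENNReal.ofReal
      ((f (Function.update x i p.1) - f (Function.update x i p.2)) ^ 2) ∂(ν.prod ν) ≤
        c * ∫⁻ a, h i (Function.update x i a) ∂ν) :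
    ∫⁻ z, ENNReal.ofReal ((f z.1 - f z.2) ^ 2)
      ∂((Measure.pi fun _ : ι => ν).prod (Measure.pi fun _ : ι => ν)) ≤
        c * ∑ i, ∫⁻ x, h i x ∂(Measure.pi fun _ : ι => ν) := by
  have hfst : MeasurePreserving (fun (ω : ι → α × α) j => (ω j).1)
      (Measure.pi fun _ : ι => ν.prod ν) (Measure.pi fun _ : ι => ν) :=
    measurePreserving_pi (fun _ : ι => ν.prod ν) (fun _ : ι => ν) (f := fun _ => Prod.fst)
      fun _ => measurePreserving_fst
  have hgm : Measurable fun ω : ι → α × α => f fun j => (ω j).1 := hf.comp hfst.measurable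
  have hupd : ∀ (i : ι) (ω : ι → α × α) (p : α × α),
      (fun j => (Function.update ω i p j).1) = Function.update (fun j => (ω j).1) i p.1 := by
    intro i ω p; ext j
    by_cases hj : j = i
    · subst hj; simp
    · simp [hj]
  have hupd' : ∀ (i : ι) (ω : ι → α × α) (p : α × α),
      (fun j => (swapOn {i} (Function.update ω i p) j).1) =
        Function.update (fun j => (ω j).1) i p.2 := by
    intro i ω p; ext j
    by_cases hj : j = i
    · subst hj; simp [swapOn]
    · simp [swapOn, hj]
  have hcoord : ∀ i, ∫⁻ ω, ENNReal.ofReal ((f (fun j => (ω j).1) -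
      f (fun j => (swapOn {i} ω j).1)) ^ 2) ∂(Measure.pi fun _ : ι => ν.prod ν) ≤
        c * ∫⁻ x, h i x ∂(Measure.pi fun _ : ι => ν) := by
    intro i
    have hsm := (measurePreserving_swapOn ν {i}).measurable
    have hm1 : Measurable fun ω : ι → α × α => ENNReal.ofReal ((f (fun j => (ω j).1) -
        f (fun j => (swapOn {i} ω j).1)) ^ 2) := by
      have := hgm.comp hsm
      exact ENNReal.measurable_ofReal.comp ((hgm.sub this).pow_const 2)
    have hm4 : Measurable fun ω : ι → α × α => h i (fun j => (ω j).1) :=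
      (hh i).comp hfst.measurable
    have hm2 : Measurable fun ω : ι → α × α => c * h i (fun j => (ω j).1) :=
      hm4.const_mul c
    rw [← hfst.lintegral_comp (hh i), ← lintegral_const_mul _ hm4]
    rcases isEmpty_or_nonempty (ι → α × α) with he | ⟨⟨ω₀⟩⟩
    · simp
    -- integrate first in the pair of `i`-th coordinates, all the others being fixed
    rw [lintegral_eq_lmarginal_univ ω₀, lintegral_eq_lmarginal_univ ω₀,
      lmarginal_erase' _ hm1 (Finset.mem_univ i), lmarginal_erase' _ hm2 (Finset.mem_univ i)]
    refine lmarginal_mono (fun ω => ?_) ω₀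
    simp only [hupd, hupd']
    refine (H i _).trans_eq ?_
    have hm3 : Measurable fun a => h i (Function.update (fun j => (ω j).1) i a) :=
      (hh i).comp (measurable_update _)
    rw [← lintegral_const_mul _ hm3]
    exact (measurePreserving_fst.lintegral_comp (hm3.const_mul c)).symm
  have hprod := measurePreserving_arrowProdEquivProdArrow α α ι (fun _ => ν) (fun _ => ν)
  rw [← hprod.lintegral_comp (by fun_prop), Finset.mul_sum]
  refine le_trans (le_of_eq ?_) ((lintegral_sq_sub_swapOn_le ν hgm Finset.univ).trans
    (Finset.sum_le_sum fun i _ => hcoord i))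
  refine lintegral_congr fun ω => ?_
  simp [swapOn, MeasurableEquiv.arrowProdEquivProdArrow, Equiv.arrowProdEquivProdArrow]

end Tensorization

/-! ### The standard Gaussian measure on Euclidean space -/

theorem absolutelyContinuous_pi_fin {α : Type*} [MeasurableSpace α] {μ ν : Measure α}
    [SigmaFinite μ] [SigmaFinite ν] (h : μ ≪ ν) (n : ℕ) :
    (Measure.pi fun _ : Fin n => μ) ≪ Measure.pi fun _ : Fin n => ν := by
  induction n with
  | zero => rw [Measure.pi_of_empty, Measure.pi_of_empty]
  | succ n ih =>
    have h1 := (measurePreserving_piFinSuccAbove (fun _ : Fin (n + 1) => μ) 0).symm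
    have h2 := (measurePreserving_piFinSuccAbove (fun _ : Fin (n + 1) => ν) 0).symm
    rw [← h1.map_eq, ← h2.map_eq]
    exact (h.prod ih).map (MeasurableEquiv.measurable _)

theorem stdGaussian_absolutelyContinuous (n : ℕ) :
    stdGaussian (EuclideanSpace ℝ (Fin n)) ≪ volume := by
  rw [← map_pi_eq_stdGaussian, ← (PiLp.volume_preserving_toLp (Fin n)).map_eq]
  exact (absolutelyContinuous_pi_fin (gaussianReal_absolutelyContinuous 0 one_ne_zero) n).map
    (WithLp.measurable_toLp 2 _)

section Slices

variable {n : ℕ} {φ : EuclideanSpace ℝ (Fin n) → ℝ}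

theorem toLp_update_add (x : Fin n → ℝ) (i : Fin n) (s t : ℝ) :
    WithLp.toLp 2 (Function.update x i (s + t)) =
      WithLp.toLp 2 (Function.update x i s) + t • EuclideanSpace.single i (1 : ℝ) := by
  ext j
  by_cases hj : j = i
  · subst hj; simp
  · simp [hj]

theorem deriv_comp_toLp_update (x : Fin n → ℝ) (i : Fin n) (s : ℝ) :
    deriv (fun r => φ (WithLp.toLp 2 (Function.update x i r))) s =
      lineDeriv ℝ φ (WithLp.toLp 2 (Function.update x i s)) (EuclideanSpace.single i 1) := by
  simp_rw [lineDeriv, ← toLp_update_add]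
  rw [deriv_comp_const_add (fun r => φ (WithLp.toLp 2 (Function.update x i r))) s 0, add_zero]

theorem LipschitzWith.comp_toLp_update {K : ℝ≥0} (hφ : LipschitzWith K φ) (x : Fin n → ℝ)
    (i : Fin n) : LipschitzWith K fun r => φ (WithLp.toLp 2 (Function.update x i r)) := by
  refine LipschitzWith.of_dist_le_mul fun r s => (hφ.dist_le_mul _ _).trans_eq ?_
  have h := toLp_update_add x i s (r - s)
  rw [add_sub_cancel] at h
  rw [h, dist_eq_norm, add_sub_cancel_left, norm_smul, PiLp.norm_single, norm_one,
    mul_one, Real.dist_eq, Real.norm_eq_abs]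

theorem sum_lineDeriv_sq_eq_norm_gradient_sq {x : EuclideanSpace ℝ (Fin n)}
    (hx : DifferentiableAt ℝ φ x) :
    ∑ i, lineDeriv ℝ φ x (EuclideanSpace.single i 1) ^ 2 = ‖∇ φ x‖ ^ 2 := by
  rw [EuclideanSpace.real_norm_sq_eq]
  refine Finset.sum_congr rfl fun i _ => ?_
  have h : inner ℝ (∇ φ x) (EuclideanSpace.single i (1 : ℝ)) =
      fderiv ℝ φ x (EuclideanSpace.single i 1) := by
    rw [gradient, InnerProductSpace.toDual_symm_apply]
  rw [hx.lineDeriv_eq_fderiv, ← h, EuclideanSpace.inner_single_right]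
  simp

end Slices

theorem poincareIneq_stdGaussian {n : ℕ} {φ : EuclideanSpace ℝ (Fin n) → ℝ} {K : ℝ≥0}
    (hφ : LipschitzWith K φ) : PoincareIneq (stdGaussian (EuclideanSpace ℝ (Fin n))) φ := by
  refine poincareIneq_of_lintegral_le hφ ?_
  have hd : ∀ᵐ x ∂(stdGaussian (EuclideanSpace ℝ (Fin n))), DifferentiableAt ℝ φ x :=
    (stdGaussian_absolutelyContinuous n).ae_le hφ.ae_differentiableAt
  have hφm : Measurable φ := hφ.continuous.measurable
  have hL : MeasurePreserving (WithLp.toLp 2) (Measure.pi fun _ : Fin n => gaussianReal 0 1)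
      (stdGaussian (EuclideanSpace ℝ (Fin n))) :=
    ⟨WithLp.measurable_toLp 2 _, map_pi_eq_stdGaussian⟩
  have hlm : ∀ i : Fin n, Measurable fun x => ENNReal.ofReal
      (lineDeriv ℝ φ x (EuclideanSpace.single i 1) ^ 2) := fun i =>
    ENNReal.measurable_ofReal.comp ((measurable_lineDeriv hφ.continuous).pow_const 2)
  have key := lintegral_sq_sub_pi_le (gaussianReal 0 1)
    (f := fun x : Fin n → ℝ => φ (WithLp.toLp 2 x))
    (hφm.comp hL.measurable) (h := fun i x => ENNReal.ofReal
      (lineDeriv ℝ φ (WithLp.toLp 2 x) (EuclideanSpace.single i 1) ^ 2))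
    (fun i => (hlm i).comp hL.measurable) (c := 2) (fun i x => by
      have h := (hφ.comp_toLp_update x i).lintegral_sq_sub_gaussianReal_le
      simpa only [deriv_comp_toLp_update] using h)
  have h1 := (hL.prod hL).lintegral_comp (f := fun z => ENNReal.ofReal ((φ z.1 - φ z.2) ^ 2))
    (by fun_prop)
  simp only [Prod.map_fst, Prod.map_snd] at h1
  rw [← h1]
  refine key.trans_eq ?_
  rw [ENNReal.ofReal_mul zero_le_two, ENNReal.ofReal_ofNat,
    ofReal_integral_eq_lintegral_ofReal hφ.integrable_norm_gradient_sq
      (Eventually.of_forall fun x => by positivity)]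
  congr 1
  calc _ = ∑ i, ∫⁻ x, ENNReal.ofReal (lineDeriv ℝ φ x (EuclideanSpace.single i 1) ^ 2)
        ∂(stdGaussian (EuclideanSpace ℝ (Fin n))) :=
        Finset.sum_congr rfl fun i _ => hL.lintegral_comp (hlm i)
    _ = ∫⁻ x, ∑ i, ENNReal.ofReal (lineDeriv ℝ φ x (EuclideanSpace.single i 1) ^ 2)
        ∂(stdGaussian (EuclideanSpace ℝ (Fin n))) :=
        (lintegral_finsetSum _ fun i _ => hlm i).symm
    _ = _ := by
        refine lintegral_congr_ae (hd.mono fun x hx => ?_)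
        simp only
        rw [← ENNReal.ofReal_sum_of_nonneg fun i _ => sq_nonneg _,
          sum_lineDeriv_sq_eq_norm_gradient_sq hx]

theorem corollary3 (n : ℕ) :
    (∀ (φ : EuclideanSpace ℝ (Fin n) → ℝ) (K : ℝ≥0), LipschitzWith K φ →
      (∀ᵐ x ∂(stdGaussian (EuclideanSpace ℝ (Fin n))), DifferentiableAt ℝ φ x) ∧
      PoincareIneq (stdGaussian (EuclideanSpace ℝ (Fin n))) φ) ∧
    (∀ (μ : Measure (EuclideanSpace ℝ (Fin n))) [IsProbabilityMeasure μ]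
      (w : EuclideanSpace ℝ (Fin n) → ℝ),
      (∀ x, 0 ≤ w x) → ConvexOn ℝ Set.univ w →
      (∀ᶠ x in 𝓝 (0 : EuclideanSpace ℝ (Fin n)), (1 / 4 : ℝ) * ‖x‖ ^ 2 ≤ w x) →
      PropertyTau μ w →
      ∀ (φ : EuclideanSpace ℝ (Fin n) → ℝ) (K : ℝ≥0), LipschitzWith K φ →
        (∀ᵐ x ∂μ, DifferentiableAt ℝ φ x) → PoincareIneq μ φ) :=
  ⟨fun _ _ hφ => ⟨(stdGaussian_absolutelyContinuous n).ae_le hφ.ae_differentiableAt,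
    poincareIneq_stdGaussian hφ⟩,
    fun _ _ _ hw hconv hloc hτ _ _ hφ hd => hτ.poincareIneq hw hconv hloc hφ hd⟩
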